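/- Let $G$ be any group (no topology) and let $E$ be a Hausdorff locally convex real topological vector space. Let $C\subseteq E$ be a convex cone that is proper, i.e. $C\cap(-C)=\{0\}$, and that is locally compact in the topology induced by the weak topology $\sigma(E,E')$. Suppose that $G$ acts on $E$ by continuous linear maps preserving $C$. Assume that the representation is of locally bounded type, i.e. there is $x\in C$ with $x\neq 0$ whose orbit $Gx$ is bounded in $E$ (absorbed by every neighbourhood of $0$). Assume also that the action is distal on $C$, i.e. for all $x\neq y$ in $C$ the point $0$ does not lie in the closure of $\{gx-gy : g\in G\}$ in $E$ (for the given topology of $E$). Then $G$ fixes a non-zero point in $C$: there is $x\in C$ with $x\neq 0$ and $gx=x$ for all $g\in G$. -/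

import Mathlib

open scoped Pointwise

/-- A convex cone `C` is proper if `C ∩ (-C) = {0}`; in particular it contains `0`. -/
def ConvexCone.IsProperCone {E : Type*} [AddCommGroup E] [Module ℝ E]
    (C : ConvexCone ℝ E) : Prop :=
  (C : Set E) ∩ -(C : Set E) = {0}

/-- A subset of a topological vector space is weakly locally compact if it is a locally compact
space for the topology induced by the weak topology `σ(E, E')`. -/
def IsWeaklyLocallyCompact {E : Type*} [AddCommGroup E] [Module ℝ E] [TopologicalSpace E]
    [IsTopologicalAddGroup E] [ContinuousSMul ℝ E] (S : Set E) : Prop :=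
  LocallyCompactSpace ↥((toWeakSpace ℝ E) '' S : Set (WeakSpace ℝ E))

section Representation

variable {G E : Type*} [Group G] [AddCommGroup E] [Module ℝ E] [TopologicalSpace E]

/-- A representation of `G` on the cone `C`: the continuous linear representation `π` of `G` on the
ambient space is order-preserving, i.e. every `π g` maps `C` into itself. -/
def IsRepresentationOnCone (π : G →* (E →L[ℝ] E)) (C : ConvexCone ℝ E) : Prop :=
  ∀ g : G, ∀ x ∈ C, π g x ∈ C

/-- Locally bounded type: some non-zero element of the cone has a bounded orbit
(absorbed by every neighbourhood of zero). -/
def IsLocallyBoundedType (π : G →* (E →L[ℝ] E)) (C : ConvexCone ℝ E) : Prop :=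
  ∃ x ∈ C, x ≠ 0 ∧ Bornology.IsVonNBounded ℝ (Set.range fun g : G => π g x)

/-- The action is distal on `S`: for distinct `x, y ∈ S`, no net `π (g_α) x - π (g_α) y` converges
to zero in the given topology of `E`. -/
def IsDistalOn (π : G →* (E →L[ℝ] E)) (S : Set E) : Prop :=
  ∀ x ∈ S, ∀ y ∈ S, x ≠ y → (0 : E) ∉ closure (Set.range fun g : G => π g x - π g y)

end Representation

/-! ### Compact convex sets: extreme points, Baire category, slices of small diameter. -/

section Compactness

open Set Filter Topology

/-! By Klee's theorem, `C` carries a continuous functional `f`, positive off `0`, whose slabs `{x ∈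
C | f x ≤ M}` are weakly compact. On the bounded orbit `f` is bounded above. Distality against `0`
gives a continuous seminorm that is at least `1` on the orbit; as it is bounded on a slab, `f` is
bounded below there by some `c > 0`. So the closed convex hull of the orbit is weakly compact,
invariant and misses `0`, and Ryll-Nardzewski's theorem gives a fixed point.

That theorem is proved following Namioka and Asplund: a fixed point `x` of the average over a finite
`T` must be fixed by each element of `T`. Otherwise, cut from the closed hull of a countable orbit
of `x` a piece of small diameter with closed convex complement; a point `π w x` in the piece is the
average of the `π w (π g x)`, so one of these lies in the piece too, against distality. -/

theorem IsCompact.exists_isOpen_inter_subset_of_subset_iUnion {X : Type*} [TopologicalSpace X]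
    [T2Space X] {Q : Set X} (hQ : IsCompact Q) (hne : Q.Nonempty) {ι : Type*} [Countable ι]
    {f : ι → Set X} (hf : ∀ i, IsClosed (f i)) (hcov : Q ⊆ ⋃ i, f i) :
    ∃ i, ∃ V : Set X, IsOpen V ∧ (Q ∩ V).Nonempty ∧ Q ∩ V ⊆ f i := by
  have : CompactSpace Q := isCompact_iff_compactSpace.1 hQ
  have : Nonempty Q := hne.to_subtype
  obtain ⟨i, q, hq⟩ := nonempty_interior_of_iUnion_of_closed
    (f := fun i => ((↑) : Q → X) ⁻¹' f i) (fun i => (hf i).preimage continuous_subtype_val)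
    (by
      refine eq_univ_of_forall fun q => ?_
      obtain ⟨i, hi⟩ := mem_iUnion.1 (hcov q.2)
      exact mem_iUnion.2 ⟨i, hi⟩)
  obtain ⟨U, hU, hUo, hqU⟩ := mem_interior.1 hq
  obtain ⟨V, hV, rfl⟩ := isOpen_induced_iff.1 hUo
  exact ⟨i, V, hV, ⟨q, q.2, hqU⟩, fun x hx => hU (show (⟨x, hx.1⟩ : Q) ∈ _ from hx.2)⟩

variable {F : Type*} [AddCommGroup F] [Module ℝ F] [TopologicalSpace F]
  [IsTopologicalAddGroup F] [ContinuousSMul ℝ F]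

theorem IsCompact.convexJoin {s t : Set F} (hs : IsCompact s) (ht : IsCompact t) :
    IsCompact (convexJoin ℝ s t) := by
  have h : IsCompact ((fun q : ℝ × F × F => (1 - q.1) • q.2.1 + q.1 • q.2.2) ''
      (Icc (0 : ℝ) 1 ×ˢ s ×ˢ t)) :=
    (isCompact_Icc.prod (hs.prod ht)).image (by fun_prop)
  convert h using 1
  ext x
  simp only [mem_convexJoin, segment_eq_image, mem_image, Prod.exists, mem_prod]
  constructor
  · rintro ⟨a, ha, b, hb, θ, hθ, rfl⟩
    exact ⟨θ, a, b, ⟨hθ, ha, hb⟩, rfl⟩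
  · rintro ⟨θ, a, b, ⟨hθ, ha, hb⟩, rfl⟩
    exact ⟨a, ha, b, hb, θ, hθ, rfl⟩

theorem IsCompact.convexHull_union {s t : Set F} (hs : IsCompact s) (ht : IsCompact t)
    (hsc : Convex ℝ s) (htc : Convex ℝ t) : IsCompact (convexHull ℝ (s ∪ t)) := by
  rcases s.eq_empty_or_nonempty with rfl | hs0
  · simpa [htc.convexHull_eq] using ht
  rcases t.eq_empty_or_nonempty with rfl | ht0
  · simpa [hsc.convexHull_eq] using hs
  rw [hsc.convexHull_union htc hs0 ht0]
  exact hs.convexJoin ht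

theorem isCompact_convexHull_biUnion {ι : Type*} (I : Finset ι) {K : ι → Set F}
    (hK : ∀ i ∈ I, IsCompact (K i)) (hc : ∀ i ∈ I, Convex ℝ (K i)) :
    IsCompact (convexHull ℝ (⋃ i ∈ I, K i)) := by
  classical
  induction I using Finset.induction_on with
  | empty => simp
  | insert a I ha ih =>
    rw [Finset.set_biUnion_insert]
    have h : convexHull ℝ (K a ∪ ⋃ i ∈ I, K i) = convexHull ℝ (K a ∪ convexHull ℝ (⋃ i ∈ I, K i)) := by
      refine Subset.antisymm (convexHull_mono (union_subset_union_right _ (subset_convexHull ℝ _)))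
        (convexHull_min (union_subset ?_ ?_) (convex_convexHull ℝ _))
      · exact subset_union_left.trans (subset_convexHull ℝ _)
      · exact convexHull_mono subset_union_right
    rw [h]
    exact (hK a (by simp)).convexHull_union
      (ih (fun i hi => hK i (by simp [hi])) (fun i hi => hc i (by simp [hi]))) (hc a (by simp))
      (convex_convexHull ℝ _)

/-- Only lower semicontinuity of `p` is assumed, since a continuous seminorm need not be weakly
continuous. By Baire, `p` is bounded near some `x₀` in `K`, and a contraction towards `x₀` carries
all of `K` there. -/
theorem IsCompact.exists_seminorm_le [T2Space F] {K : Set F} (hK : IsCompact K) (hc : Convex ℝ K)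
    (p : Seminorm ℝ F) (hp : ∀ r, IsClosed {x | p x ≤ r}) : ∃ M, ∀ x ∈ K, p x ≤ M := by
  rcases K.eq_empty_or_nonempty with rfl | hne
  · exact ⟨0, by simp⟩
  obtain ⟨n, V, hV, ⟨x₀, hx₀, hx₀V⟩, hsub⟩ :=
    hK.exists_isOpen_inter_subset_of_subset_iUnion hne (f := fun n : ℕ => {x | p x ≤ n})
      (fun n => hp n) (fun x _ => mem_iUnion.2 (exists_nat_ge (p x)))
  have hev : ∀ᶠ t : ℝ in 𝓝 0, ∀ k ∈ K, x₀ + t • (k - x₀) ∈ V := by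
    refine hK.eventually_forall_of_forall_eventually fun k _ => ?_
    have hcont : Continuous fun z : ℝ × F => x₀ + z.1 • (z.2 - x₀) := by fun_prop
    exact hcont.continuousAt.eventually_mem (hV.mem_nhds (by simpa using hx₀V))
  obtain ⟨t, ht, ht0, ht1⟩ : ∃ t : ℝ, (∀ k ∈ K, x₀ + t • (k - x₀) ∈ V) ∧ 0 < t ∧ t < 1 := by
    have h2 : ∀ᶠ t : ℝ in 𝓝[>] 0, t < 1 := by
      filter_upwards [Ioo_mem_nhdsGT (zero_lt_one' ℝ)] with t ht using ht.2
    obtain ⟨t, h⟩ := ((hev.filter_mono nhdsWithin_le_nhds).and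
      (h2.and self_mem_nhdsWithin)).exists
    exact ⟨t, h.1, h.2.2, h.2.1⟩
  refine ⟨(n + p x₀) / t, fun k hk => ?_⟩
  rw [le_div_iff₀ ht0]
  have hmem : x₀ + t • (k - x₀) ∈ K := hc.add_smul_sub_mem hx₀ hk ⟨ht0.le, ht1.le⟩
  have h1 : p (x₀ + t • (k - x₀)) ≤ n := hsub ⟨hmem, ht k hk⟩
  have h2 : t • k = (x₀ + t • (k - x₀)) + (-(1 - t)) • x₀ := by module
  have h3 : p (t • k) = t * p k := by rw [map_smul_eq_mul, Real.norm_of_nonneg ht0.le]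
  have h4 : p ((-(1 - t)) • x₀) = (1 - t) * p x₀ := by
    rw [map_smul_eq_mul, norm_neg, Real.norm_of_nonneg (by linarith)]
  have h5 := map_add_le_add p (x₀ + t • (k - x₀)) ((-(1 - t)) • x₀)
  rw [← h2, h3, h4] at h5
  nlinarith [apply_nonneg p x₀]

/-- Milman's converse to Krein-Milman. The closed hull is the hull of finitely many compact convex
pieces avoiding `e`, and an extreme point of such a hull lies in one of the pieces. -/
theorem extremePoints_closure_convexHull_subset [T2Space F] [LocallyConvexSpace ℝ F] {Q : Set F}
    (hQ : IsCompact Q) (hK : IsCompact (closure (convexHull ℝ Q))) :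
    (closure (convexHull ℝ Q)).extremePoints ℝ ⊆ Q := by
  intro e he
  by_contra heQ
  have hsep : ∀ q ∈ Q, ∃ H : Set F, IsClosed H ∧ Convex ℝ H ∧ e ∉ H ∧ H ∈ 𝓝 q := by
    intro q hq
    obtain ⟨f, hf⟩ := geometric_hahn_banach_point_point (x := q) (y := e)
      (fun h => heQ (h ▸ hq))
    obtain ⟨c, hc1, hc2⟩ := exists_between hf
    refine ⟨{x | f x ≤ c}, isClosed_le f.continuous continuous_const,
      convex_halfSpace_le f.toLinearMap.isLinear c, by simpa using hc2, ?_⟩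
    filter_upwards [(isOpen_Iio.preimage f.continuous).mem_nhds (show q ∈ f ⁻¹' Iio c from hc1)]
      with x hx using le_of_lt hx
  choose! H hHc hHconv hHe hHn using hsep
  obtain ⟨t, htQ, htc⟩ := hQ.elim_nhds_subcover H hHn
  have hcomp : IsCompact (convexHull ℝ (⋃ q ∈ t, H q ∩ closure (convexHull ℝ Q))) :=
    isCompact_convexHull_biUnion t (fun q hq => hK.inter_left (hHc q (htQ q hq)))
      (fun q hq => (hHconv q (htQ q hq)).inter (convex_convexHull ℝ Q).closure)
  have hQs : Q ⊆ ⋃ q ∈ t, H q ∩ closure (convexHull ℝ Q) := by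
    intro x hx
    obtain ⟨q, hq, hxq⟩ := mem_iUnion₂.1 (htc hx)
    exact mem_iUnion₂.2 ⟨q, hq, hxq, subset_closure (subset_convexHull ℝ _ hx)⟩
  have h1 : closure (convexHull ℝ Q) ⊆ convexHull ℝ (⋃ q ∈ t, H q ∩ closure (convexHull ℝ Q)) :=
    closure_minimal (convexHull_mono hQs) hcomp.isClosed
  have h2 : convexHull ℝ (⋃ q ∈ t, H q ∩ closure (convexHull ℝ Q)) ⊆ closure (convexHull ℝ Q) :=
    convexHull_min (iUnion₂_subset fun q _ => inter_subset_right) (convex_convexHull ℝ Q).closure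
  have h3 := extremePoints_convexHull_subset
    (inter_extremePoints_subset_extremePoints_of_subset h2 ⟨h1 he.1, he⟩)
  obtain ⟨q, hq, hxq, -⟩ := mem_iUnion₂.1 h3
  exact hHe q (htQ q hq) hxq

/-- Markov-Kakutani for one map: Cesàro means of an orbit are almost invariant, and any cluster
point is fixed. -/
theorem IsCompact.exists_isFixedPt_of_mapsTo [T2Space F] {K : Set F} (hK : IsCompact K)
    (hc : Convex ℝ K) (hne : K.Nonempty) (h : F →L[ℝ] F) (hh : MapsTo h K K) :
    ∃ x ∈ K, h x = x := by
  obtain ⟨x₀, hx₀⟩ := hne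
  have hit : ∀ k, (h^[k]) x₀ ∈ K := fun k => hh.iterate k hx₀
  let a : ℕ → F := fun n => ∑ k ∈ Finset.range (n + 1), ((n : ℝ) + 1)⁻¹ • (h^[k]) x₀
  have ha : ∀ n, a n ∈ K := fun n => hc.sum_mem (fun _ _ => by positivity)
    (by simp; field_simp) (fun k _ => hit k)
  have hdiff : ∀ n, h (a n) - a n = ((n : ℝ) + 1)⁻¹ • ((h^[n + 1]) x₀ - x₀) := by
    intro n
    simp only [a, map_sum, map_smul, ← Finset.smul_sum, ← smul_sub, ← Finset.sum_sub_distrib]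
    congr 1
    simp only [← Function.iterate_succ_apply' h]
    exact Finset.sum_range_sub (fun k => (h^[k]) x₀) (n + 1)
  have hbdd : Bornology.IsVonNBounded ℝ (K - K) := by
    let _ := IsTopologicalAddGroup.rightUniformSpace F
    have := isUniformAddGroup_of_addCommGroup (G := F)
    have hKK : IsCompact (K - K) := by simpa [sub_eq_add_neg] using hK.add hK.neg
    exact hKK.totallyBounded.isVonNBounded ℝ
  have hlim : Tendsto (fun n => h (a n) - a n) atTop (𝓝 0) := by
    simp only [hdiff]
    refine hbdd.smul_tendsto_zero (.of_forall fun n => sub_mem_sub (hit _) hx₀) ?_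
    simpa [one_div] using tendsto_one_div_add_atTop_nhds_zero_nat (𝕜 := ℝ)
  obtain ⟨x, hxK, hx⟩ := hK.ultrafilter_le_nhds ((hyperfilter ℕ).map a)
    (le_principal_iff.2 (Ultrafilter.mem_map.2 (univ_mem' ha)))
  refine ⟨x, hxK, ?_⟩
  have hx' : Tendsto a (hyperfilter ℕ : Filter ℕ) (𝓝 x) := hx
  have h1 := ((h.continuous.tendsto x).comp hx').sub hx'
  have h2 := hlim.mono_left (Nat.hyperfilter_le_atTop)
  exact sub_eq_zero.1 (tendsto_nhds_unique h1 h2)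

/-- Baire on the closure of the extreme points finds a relatively open part inside one `p`-ball. `K`
is then the hull of a small piece `K₂` and the closed hull `K₁` of the rest; removing the points
with weight at least `r` on `K₁` leaves a small set. -/
theorem IsCompact.exists_convex_isClosed_seminorm_sub_le [T2Space F] [LocallyConvexSpace ℝ F]
    {K : Set F} (hK : IsCompact K) (hc : Convex ℝ K) (hne : K.Nonempty)
    (p : Seminorm ℝ F) (hp : ∀ r, IsClosed {x | p x ≤ r}) {ε : ℝ} (hε : 0 < ε) {D : Set F}
    (hD : D.Countable) (hKD : ∀ k ∈ K, ∃ d ∈ D, p (k - d) ≤ ε) :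
    ∃ C : Set F, Convex ℝ C ∧ IsClosed C ∧ ¬ K ⊆ C ∧ ∀ x ∈ K \ C, ∀ y ∈ K \ C, p (x - y) ≤ 4 * ε := by
  obtain ⟨M, hM⟩ := hK.exists_seminorm_le hc p hp
  have hM0 : 0 ≤ M := (apply_nonneg p _).trans (hM _ hne.choose_spec)
  have hball : ∀ d, IsClosed {x | p (x - d) ≤ ε} := fun d =>
    (hp ε).preimage (continuous_id.sub continuous_const)
  have hballc : ∀ d, Convex ℝ {x | p (x - d) ≤ ε} := fun d => by
    simpa [Seminorm.closedBall] using p.convex_closedBall d ε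
  set Q := closure (K.extremePoints ℝ) with hQdef
  have hQK : Q ⊆ K := closure_minimal extremePoints_subset hK.isClosed
  have hQ : IsCompact Q := hK.of_isClosed_subset isClosed_closure hQK
  have hQne : Q.Nonempty := (hK.extremePoints_nonempty hne).closure
  have := hD.to_subtype
  obtain ⟨⟨d, hd⟩, V, hV, ⟨q, hqQ, hqV⟩, hsub⟩ :=
    hQ.exists_isOpen_inter_subset_of_subset_iUnion hQne (f := fun d : D => {x | p (x - d) ≤ ε})
      (fun d => hball d) (fun x hx => by
        obtain ⟨d, hd, h⟩ := hKD x (hQK hx)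
        exact mem_iUnion.2 ⟨⟨d, hd⟩, h⟩)
  set K₁ := closure (convexHull ℝ (Q \ V)) with hK₁def
  set K₂ := K ∩ {x | p (x - d) ≤ ε} with hK₂def
  have hK₁K : K₁ ⊆ K :=
    closure_minimal (convexHull_min (sdiff_subset.trans hQK) hc) hK.isClosed
  have hK₁ : IsCompact K₁ := hK.of_isClosed_subset isClosed_closure hK₁K
  have hK₁c : Convex ℝ K₁ := (convex_convexHull ℝ _).closure
  have hK₂ : IsCompact K₂ := hK.inter_right (hball d)
  have hK₂c : Convex ℝ K₂ := hc.inter (hballc d)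
  have hQ12 : Q ⊆ K₁ ∪ K₂ := by
    intro x hx
    by_cases hxV : x ∈ V
    · exact Or.inr ⟨hQK hx, hsub ⟨hx, hxV⟩⟩
    · exact Or.inl (subset_closure (subset_convexHull ℝ _ ⟨hx, hxV⟩))
  have hKhull : K ⊆ convexHull ℝ (K₁ ∪ K₂) := by
    rw [← closure_convexHull_extremePoints hK hc]
    exact closure_minimal (convexHull_mono (subset_closure.trans hQ12))
      (hK₁.convexHull_union hK₂ hK₁c hK₂c).isClosed
  -- `V` contains an extreme point of `K`, which Milman's theorem keeps out of `K₁`.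
  have hext : ¬ K.extremePoints ℝ ⊆ K₁ := by
    intro hle
    obtain ⟨e, heV, he⟩ := mem_closure_iff.1 hqQ V hV hqV
    have := extremePoints_closure_convexHull_subset (hQ.diff hV) hK₁
      (inter_extremePoints_subset_extremePoints_of_subset hK₁K ⟨hle he, he⟩)
    exact this.2 heV
  have hK₂ne : K₂.Nonempty := ⟨q, hQK hqQ, hsub ⟨hqQ, hqV⟩⟩
  rcases K₁.eq_empty_or_nonempty with hK₁e | hK₁ne
  · refine ⟨∅, convex_empty, isClosed_empty, fun h => by simpa using h hne.choose_spec, ?_⟩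
    have hKK : K ⊆ K₂ := by simpa [hK₁e, hK₂c.convexHull_eq] using hKhull
    intro x hx y hy
    have h1 : p (x - d) ≤ ε := (hKK hx.1).2
    have h2 : p (y - d) ≤ ε := (hKK hy.1).2
    have h3 := map_sub_le_add p (x - d) (y - d)
    rw [sub_sub_sub_cancel_right] at h3
    linarith
  rw [hK₁c.convexHull_union hK₂c hK₁ne hK₂ne] at hKhull
  -- Weight below `r` on `K₁` moves a point of `K₂` by at most `r * (2 * M) ≤ ε`.
  set r : ℝ := ε / (2 * M + 2 * ε) with hr
  have hden : 0 < 2 * M + 2 * ε := by positivity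
  have hr0 : 0 < r := by positivity
  have hr1 : r < 1 := by rw [hr, div_lt_one hden]; linarith
  have hrM : r * (2 * M) ≤ ε := by
    rw [hr, div_mul_eq_mul_div, div_le_iff₀ hden]; nlinarith
  have hmix : r • K₁ + (1 - r) • K₂ ⊆ K := by
    rintro _ ⟨_, ⟨a, ha, rfl⟩, _, ⟨b, hb, rfl⟩, rfl⟩
    exact hc (hK₁K ha) hb.1 hr0.le (by linarith) (by ring)
  refine ⟨_root_.convexJoin ℝ K₁ (r • K₁ + (1 - r) • K₂),
    hK₁c.convexJoin ((hK₁c.smul r).add (hK₂c.smul _)),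
    (hK₁.convexJoin ((hK₁.smul r).add (hK₂.smul _))).isClosed, ?_, ?_⟩
  · intro hKC
    refine hext fun e he => ?_
    obtain ⟨a, ha, b, hb, heab⟩ := mem_convexJoin.1 (hKC he.1)
    rcases (mem_extremePoints_iff_forall_segment.1 he).2 a (hK₁K ha) b (hmix hb) heab with h | h
    · exact h ▸ ha
    · obtain ⟨_, ⟨c, hcK, rfl⟩, _, ⟨c', hcK', rfl⟩, hcc⟩ := hb
      have := he.2 (hK₁K hcK) hcK'.1 ⟨r, 1 - r, hr0, by linarith, by ring, hcc.trans h⟩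
      exact this ▸ hcK
  · have key : ∀ x ∈ K \ _root_.convexJoin ℝ K₁ (r • K₁ + (1 - r) • K₂), p (x - d) ≤ 2 * ε := by
      rintro x ⟨hxK, hxC⟩
      obtain ⟨k₁, hk₁, k₂, hk₂, a, b, ha, hb, hab, rfl⟩ := mem_convexJoin.1 (hKhull hxK)
      have har : a < r := by
        by_contra! hra
        refine hxC (mem_convexJoin.2 ⟨k₁, hk₁, r • k₁ + (1 - r) • k₂,
          add_mem_add (smul_mem_smul_set hk₁) (smul_mem_smul_set hk₂),
          (a - r) / (1 - r), b / (1 - r), div_nonneg (by linarith) (by linarith),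
          div_nonneg hb (by linarith), ?_, ?_⟩)
        · rw [← add_div, div_eq_one_iff_eq (by linarith)]; linarith
        · have h1r : (1 - r) ≠ 0 := by linarith
          have e1 : (a - r) / (1 - r) + b / (1 - r) * r = a := by
            field_simp; rw [← hab]; ring_nf; nlinarith
          have e2 : b / (1 - r) * (1 - r) = b := by field_simp
          rw [smul_add, smul_smul, smul_smul, ← add_assoc, ← add_smul, e1, e2]
      have heq : a • k₁ + b • k₂ - d = (k₂ - d) + a • (k₁ - k₂) := by
        rw [show b = 1 - a by linarith]; module
      have h1 := map_add_le_add p (k₂ - d) (a • (k₁ - k₂))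
      rw [map_smul_eq_mul, Real.norm_of_nonneg ha] at h1
      have h2 : p (k₂ - d) ≤ ε := hk₂.2
      have h3 := (map_sub_le_add p k₁ k₂).trans (add_le_add (hM _ (hK₁K hk₁)) (hM _ hk₂.1))
      have h4 : a * p (k₁ - k₂) ≤ r * (2 * M) :=
        mul_le_mul har.le (by linarith) (apply_nonneg p _) hr0.le
      rw [heq]
      linarith
    intro x hx y hy
    have h3 := map_sub_le_add p (x - d) (y - d)
    rw [sub_sub_sub_cancel_right] at h3
    linarith [key x hx, key y hy]

end Compactness

/-! ### The Ryll-Nardzewski fixed point theorem. -/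

section RyllNardzewski

open Set Filter Topology

theorem eq_of_sum_sub_eq_zero_of_seminorm_dist {F : Type*} [AddCommGroup F] [Module ℝ F]
    [TopologicalSpace F] [IsTopologicalAddGroup F] [ContinuousSMul ℝ F] [T2Space F]
    [LocallyConvexSpace ℝ F] {G : Type*} [Group G] (π : G →* (F →L[ℝ] F)) {K : Set F}
    (hK : IsCompact K) (hc : Convex ℝ K) (hinv : ∀ g, ∀ x ∈ K, π g x ∈ K) {x : F} (hx : x ∈ K)
    {T : Finset G} (hT : T.Nonempty) (hsum : ∑ g ∈ T, (π g x - x) = 0)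
    (p : Seminorm ℝ F) (hp : ∀ r, IsClosed {x | p x ≤ r})
    (hsep : ∀ A : Set F, A.Countable → ∀ ε > 0, ∃ D : Set F, D.Countable ∧
      ∀ k ∈ closure (convexHull ℝ A), ∃ d ∈ D, p (k - d) ≤ ε) :
    ∃ s : G, ∃ g ∈ T, p (π s (π g x) - π s x) < 1 := by
  -- Words in `T` keep the orbit countable, as `hsep` requires, and stay closed under right
  -- multiplication by `T`.
  let w : List T → G := fun l => (l.map (↑)).prod
  let A : Set F := range fun l : List T => π (w l) x
  have hAK : closure (convexHull ℝ A) ⊆ K :=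
    closure_minimal (convexHull_min (by rintro _ ⟨l, rfl⟩; exact hinv _ _ hx) hc) hK.isClosed
  have hA : A ⊆ closure (convexHull ℝ A) := (subset_convexHull ℝ A).trans subset_closure
  obtain ⟨D, hD, hAD⟩ := hsep A (countable_range _) (1 / 8) (by norm_num)
  obtain ⟨C, hCc, hCcl, hKC, hdiam⟩ :=
    (hK.of_isClosed_subset isClosed_closure hAK).exists_convex_isClosed_seminorm_sub_le
      (convex_convexHull ℝ A).closure ⟨π (w []) x, hA ⟨[], rfl⟩⟩ p hp (by norm_num) hD hAD
  obtain ⟨l, hl⟩ : ∃ l, π (w l) x ∉ C := by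
    by_contra! h
    exact hKC (closure_minimal (convexHull_min (by rintro _ ⟨l, rfl⟩; exact h l) hCc) hCcl)
  obtain ⟨g, hg, hgC⟩ : ∃ g ∈ T, π (w l) (π g x) ∉ C := by
    by_contra! h
    have hcard : (0 : ℝ) < T.card := by exact_mod_cast hT.card_pos
    have hmem : ∑ g ∈ T, (T.card : ℝ)⁻¹ • π (w l) (π g x) ∈ C :=
      hCc.sum_mem (fun _ _ => by positivity) (by simp [hcard.ne']) h
    have hsum' : ∑ g ∈ T, π g x = (T.card : ℝ) • x := by
      rw [Finset.sum_sub_distrib, Finset.sum_const, sub_eq_zero] at hsum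
      rw [hsum, Nat.cast_smul_eq_nsmul]
    rw [← Finset.smul_sum, ← map_sum, hsum', map_smul, smul_smul, inv_mul_cancel₀ hcard.ne',
      one_smul] at hmem
    exact hl hmem
  refine ⟨w l, g, hg, ?_⟩
  have hgA : π (w l) (π g x) ∈ A := by
    refine ⟨l ++ [⟨g, hg⟩], ?_⟩
    simp [w]
  exact (hdiam _ ⟨hA hgA, hgC⟩ _ ⟨hA ⟨l, rfl⟩, hl⟩).trans_lt (by norm_num)

variable {E : Type*} [AddCommGroup E] [Module ℝ E] [TopologicalSpace E]
  [IsTopologicalAddGroup E] [ContinuousSMul ℝ E] [LocallyConvexSpace ℝ E]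

instance WeakSpace.instLocallyConvexSpaceReal : LocallyConvexSpace ℝ (WeakSpace ℝ E) :=
  inferInstanceAs (LocallyConvexSpace ℝ (WeakBilin (topDualPairing ℝ E).flip))

theorem exists_continuous_seminorm_lt_one_subset {U : Set E} (hU : U ∈ 𝓝 (0 : E)) :
    ∃ p : Seminorm ℝ E, Continuous p ∧ ∀ x, p x < 1 → x ∈ U := by
  obtain ⟨s, hs, hsU⟩ := (nhds_hasBasis_absConvex_open ℝ E).mem_iff.1 hU
  refine ⟨gaugeSeminormFamily ℝ E ⟨s, hs⟩, with_gaugeSeminormFamily.continuous_seminorm _,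
    fun x hx => hsU ?_⟩
  have h := gaugeSeminormFamily_ball (𝕜 := ℝ) (E := E) ⟨s, hs⟩
  have : x ∈ (gaugeSeminormFamily ℝ E ⟨s, hs⟩).ball 0 1 := by simpa [Seminorm.mem_ball] using hx
  rw [h] at this
  exact this

theorem Convex.isClosed_toWeakSpace_image {s : Set E} (hs : Convex ℝ s) (hcl : IsClosed s) :
    IsClosed (toWeakSpace ℝ E '' s) := by
  rw [← hcl.closure_eq, hs.toWeakSpace_closure (𝕜 := ℝ)]
  exact isClosed_closure

/-- A seminorm on `E`, seen as a seminorm on `E` with its weak topology. -/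
noncomputable def Seminorm.toWeakSpace (p : Seminorm ℝ E) : Seminorm ℝ (WeakSpace ℝ E) :=
  p.comp (_root_.toWeakSpace ℝ E).symm.toLinearMap

omit [IsTopologicalAddGroup E] [ContinuousSMul ℝ E] [LocallyConvexSpace ℝ E] in
@[simp]
theorem Seminorm.toWeakSpace_apply (p : Seminorm ℝ E) (x : E) :
    p.toWeakSpace (_root_.toWeakSpace ℝ E x) = p x := by
  simp [Seminorm.toWeakSpace]

theorem Seminorm.isClosed_toWeakSpace_le {p : Seminorm ℝ E} (hp : Continuous p) (r : ℝ) :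
    IsClosed {x | p.toWeakSpace x ≤ r} := by
  have hconv : Convex ℝ {x | p x ≤ r} := by
    simpa [Seminorm.closedBall] using p.convex_closedBall 0 r
  convert hconv.isClosed_toWeakSpace_image (isClosed_le hp continuous_const) using 1
  ext x
  obtain ⟨x, rfl⟩ := (_root_.toWeakSpace ℝ E).surjective x
  simp

/-- By Mazur, the weak closure of the hull is its original closure, which lies in a separable closed
span. -/
theorem Seminorm.exists_countable_toWeakSpace_sub_le {p : Seminorm ℝ E} (hp : Continuous p)
    {A : Set (WeakSpace ℝ E)} (hA : A.Countable) {ε : ℝ} (hε : 0 < ε) :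
    ∃ D : Set (WeakSpace ℝ E), D.Countable ∧
      ∀ k ∈ closure (convexHull ℝ A), ∃ d ∈ D, p.toWeakSpace (k - d) ≤ ε := by
  obtain ⟨B, rfl⟩ : ∃ B : Set E, A = _root_.toWeakSpace ℝ E '' B :=
    ⟨(_root_.toWeakSpace ℝ E).symm '' A, by simp [image_image]⟩
  have hB : B.Countable := countable_of_injective_of_countable_image
    (_root_.toWeakSpace ℝ E).injective.injOn hA
  obtain ⟨c, hc, hcB⟩ := (hB.isSeparable.span (R := ℝ)).closure
  refine ⟨_root_.toWeakSpace ℝ E '' c, hc.image _, fun k hk => ?_⟩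
  rw [← LinearEquiv.coe_coe, ← LinearMap.image_convexHull, LinearEquiv.coe_coe,
    ← (convex_convexHull ℝ B).toWeakSpace_closure (𝕜 := ℝ)] at hk
  obtain ⟨k, hk, rfl⟩ := hk
  have hk' := hcB (closure_mono (convexHull_min Submodule.subset_span (Submodule.span ℝ B).convex) hk)
  have hopen : IsOpen {d | p (k - d) < ε} :=
    isOpen_lt (hp.comp (continuous_const.sub continuous_id)) continuous_const
  obtain ⟨d, hd, hdc⟩ := mem_closure_iff.1 hk' _ hopen (by simpa using hε)
  refine ⟨_, ⟨d, hdc, rfl⟩, ?_⟩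
  rw [← map_sub, Seminorm.toWeakSpace_apply]
  exact le_of_lt hd

/-- **Ryll-Nardzewski fixed point theorem** for distal linear actions on weakly compact convex
sets. -/
theorem exists_fixedPoint_of_isDistalOn [T2Space E] {G : Type*} [Group G] (π : G →* (E →L[ℝ] E))
    {K : Set E} (hK : IsCompact (toWeakSpace ℝ E '' K)) (hc : Convex ℝ K) (hne : K.Nonempty)
    (hinv : ∀ g, ∀ x ∈ K, π g x ∈ K) (hdist : IsDistalOn π K) :
    ∃ x ∈ K, ∀ g, π g x = x := by
  classical
  let ρ : G →* (WeakSpace ℝ E →L[ℝ] WeakSpace ℝ E) :=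
    { toFun := fun g => WeakSpace.map (π g)
      map_one' := by ext x; exact DFunLike.congr_fun (map_one π) x
      map_mul' := fun g h => by ext x; exact DFunLike.congr_fun (map_mul π g h) x }
  have hρ : ∀ g x, ρ g (toWeakSpace ℝ E x) = toWeakSpace ℝ E (π g x) := fun _ _ => rfl
  set K' := toWeakSpace ℝ E '' K with hK'
  have hc' : Convex ℝ K' := hc.linear_image (toWeakSpace ℝ E).toLinearMap
  have hinv' : ∀ g, ∀ x ∈ K', ρ g x ∈ K' := by
    rintro g _ ⟨x, hx, rfl⟩
    exact ⟨π g x, hinv g x hx, rfl⟩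
  have hfin : ∀ T : Finset G, (K' ∩ ⋂ g ∈ T, {x | ρ g x = x}).Nonempty := by
    intro T
    rcases T.eq_empty_or_nonempty with rfl | hT
    · exact ⟨_, ⟨_, hne.choose_spec, rfl⟩, by simp⟩
    have hcard : (0 : ℝ) < T.card := by exact_mod_cast hT.card_pos
    have hmaps : MapsTo ((T.card : ℝ)⁻¹ • ∑ g ∈ T, ρ g : WeakSpace ℝ E →L[ℝ] WeakSpace ℝ E)
        K' K' := by
      intro y hy
      have : ∑ g ∈ T, (T.card : ℝ)⁻¹ • ρ g y ∈ K' :=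
        hc'.sum_mem (fun _ _ => by positivity) (by simp [hcard.ne']) (fun g _ => hinv' g y hy)
      simpa [Finset.smul_sum, sum_apply] using this
    obtain ⟨_, ⟨x, hx, rfl⟩, hfix⟩ :=
      hK.exists_isFixedPt_of_mapsTo hc' (hne.image _) _ hmaps
    refine ⟨toWeakSpace ℝ E x, ⟨x, hx, rfl⟩, mem_iInter₂.2 fun g₀ hg₀ => ?_⟩
    by_contra hne₀
    have hsum : ∑ g ∈ T, (ρ g (toWeakSpace ℝ E x) - toWeakSpace ℝ E x) = 0 := by
      rw [Finset.sum_sub_distrib, sub_eq_zero, Finset.sum_const, ← Nat.cast_smul_eq_nsmul ℝ]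
      conv_rhs => rw [← hfix]
      simp [smul_smul, hcard.ne']
    -- Distality separates only distinct points; dropping the elements that fix `x` leaves the sum
    -- zero.
    let S := T.filter fun g => π g x ≠ x
    have hS : S.Nonempty := ⟨g₀, Finset.mem_filter.2 ⟨hg₀, fun h => hne₀ (by simp [hρ, h])⟩⟩
    have hsumS : ∑ g ∈ S, (ρ g (toWeakSpace ℝ E x) - toWeakSpace ℝ E x) = 0 := by
      rw [← hsum]
      refine Finset.sum_subset (Finset.filter_subset _ _) fun g hg hgS => ?_
      have : π g x = x := by simpa [S, hg] using hgS
      rw [hρ, this, sub_self]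
    have hU : (⋂ g ∈ S, (closure (range fun s : G => π s (π g x) - π s x))ᶜ) ∈ 𝓝 (0 : E) := by
      refine (Filter.biInter_finset_mem S).2 fun g hg => isClosed_closure.isOpen_compl.mem_nhds ?_
      exact hdist _ (hinv g x hx) _ hx (Finset.mem_filter.1 hg).2
    obtain ⟨p, hp, hpU⟩ := exists_continuous_seminorm_lt_one_subset hU
    obtain ⟨s, g, hg, hlt⟩ := eq_of_sum_sub_eq_zero_of_seminorm_dist ρ hK hc' hinv' ⟨x, hx, rfl⟩ hS
      hsumS p.toWeakSpace (Seminorm.isClosed_toWeakSpace_le hp)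
      (fun A hA ε hε => Seminorm.exists_countable_toWeakSpace_sub_le hp hA hε)
    rw [hρ, hρ, hρ, ← map_sub, Seminorm.toWeakSpace_apply] at hlt
    exact mem_iInter₂.1 (hpU _ hlt) g hg (subset_closure ⟨s, rfl⟩)
  obtain ⟨_, ⟨x, hx, rfl⟩, hfix⟩ := hK.inter_iInter_nonempty (fun g => {x | ρ g x = x})
    (fun g => isClosed_eq (ρ g).continuous continuous_id) hfin
  exact ⟨x, hx, fun g => (toWeakSpace ℝ E).injective (mem_iInter.1 hfix g)⟩

end RyllNardzewski

/-! ### Klee's theorem on locally compact cones. -/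

section Cone

open Set Filter Topology

/-- **Klee's theorem**: a proper locally compact convex cone has a compact base. -/
theorem ConvexCone.IsProperCone.exists_isCompact_le {F : Type*} [AddCommGroup F] [Module ℝ F]
    [TopologicalSpace F] [IsTopologicalAddGroup F] [ContinuousSMul ℝ F] [T2Space F]
    [LocallyConvexSpace ℝ F] {C : ConvexCone ℝ F} (hC : C.IsProperCone)
    [LocallyCompactSpace (C : Set F)] :
    ∃ f : F →L[ℝ] ℝ, (∀ x ∈ C, x ≠ 0 → 0 < f x) ∧ ∀ M, IsCompact {x | x ∈ C ∧ f x ≤ M} := by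
  have h0 : (0 : F) ∈ C :=
    (show (0 : F) ∈ (C : Set F) ∩ -(C : Set F) by rw [hC]; rfl).1
  obtain ⟨N, hN, hN0⟩ := exists_compact_mem_nhds (⟨0, h0⟩ : (C : Set F))
  obtain ⟨V, hV, hVN⟩ := mem_nhds_subtype _ _ _ |>.1 hN0
  obtain ⟨p, hp, hpV⟩ := exists_continuous_seminorm_lt_one_subset hV
  set L : Set F := {x | x ∈ C ∧ p x ≤ 1 / 2} with hL
  have hLc : IsCompact L := by
    have : L = ((↑) '' N : Set F) ∩ {x | p x ≤ 1 / 2} := by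
      ext x
      constructor
      · rintro ⟨hx, hpx⟩
        exact ⟨⟨⟨x, hx⟩, hVN (hpV x (by linarith)), rfl⟩, hpx⟩
      · rintro ⟨⟨y, -, rfl⟩, hpx⟩
        exact ⟨y.2, hpx⟩
    rw [this]
    exact (hN.image continuous_subtype_val).inter_right (isClosed_le hp continuous_const)
  have hLconv : Convex ℝ L := by
    have := C.convex.inter (p.convex_closedBall 0 (1 / 2))
    simpa [Seminorm.closedBall, hL, Set.inter_def] using this
  -- Properness makes `0` extreme; by Milman it then avoids the closed hull of `B`, and Hahn-Banach
  -- yields `f`.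
  have h0L : (0 : F) ∈ L.extremePoints ℝ := by
    refine ⟨⟨h0, by simp⟩, ?_⟩
    rintro x hx y hy ⟨a, b, ha, hb, -, hab⟩
    have : a • x ∈ (C : Set F) ∩ -(C : Set F) := by
      refine ⟨C.smul_mem ha hx.1, ?_⟩
      rw [Set.mem_neg, ← eq_neg_of_add_eq_zero_right hab]
      exact C.smul_mem hb hy.1
    rw [hC] at this
    exact (smul_eq_zero.1 this).resolve_left ha.ne'
  set B : Set F := L ∩ {x | p x = 1 / 2} with hB
  have hBc : IsCompact B := hLc.inter_right (isClosed_eq hp continuous_const)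
  have hBL : closure (convexHull ℝ B) ⊆ L :=
    closure_minimal (convexHull_min inter_subset_left hLconv) hLc.isClosed
  have h0B : (0 : F) ∉ closure (convexHull ℝ B) := by
    intro h
    have := extremePoints_closure_convexHull_subset hBc
      (hLc.of_isClosed_subset isClosed_closure hBL)
      (inter_extremePoints_subset_extremePoints_of_subset hBL ⟨h, h0L⟩)
    have h2 : p (0 : F) = 1 / 2 := this.2
    norm_num at h2
  obtain ⟨f, u, hu0, hu⟩ := geometric_hahn_banach_point_closed (convex_convexHull ℝ B).closure
    isClosed_closure h0B
  rw [map_zero] at hu0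
  -- If `p x = 0`, the compact, hence bounded, set `L` would contain arbitrarily large multiples of
  -- `x`.
  have hpos : ∀ x ∈ C, x ≠ 0 → 0 < p x := by
    intro x hx hx0
    refine (apply_nonneg p x).lt_of_ne' fun hpx => hx0 ?_
    have hmem : ∀ n : ℕ, ((n : ℝ) + 1) • x ∈ L := fun n =>
      ⟨C.smul_mem (by positivity) hx, by simp [map_smul_eq_mul, hpx]⟩
    have hbdd : Bornology.IsVonNBounded ℝ L := by
      let _ := IsTopologicalAddGroup.rightUniformSpace F
      have := isUniformAddGroup_of_addCommGroup (G := F)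
      exact hLc.totallyBounded.isVonNBounded ℝ
    have hlim := hbdd.smul_tendsto_zero (ε := fun n : ℕ => ((n : ℝ) + 1)⁻¹) (l := atTop)
      (.of_forall hmem) (by simpa [one_div] using tendsto_one_div_add_atTop_nhds_zero_nat (𝕜 := ℝ))
    have hcst : ((fun n : ℕ => ((n : ℝ) + 1)⁻¹) • fun n : ℕ => ((n : ℝ) + 1) • x) = fun _ => x := by
      funext n
      have : (n : ℝ) + 1 ≠ 0 := by positivity
      simp [smul_smul, this]
    rw [hcst] at hlim
    exact tendsto_nhds_unique tendsto_const_nhds hlim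
  have hpf : ∀ x ∈ C, 2 * p x * u ≤ f x := by
    intro x hx
    rcases eq_or_ne x 0 with rfl | hx0
    · simp
    have hpx := hpos x hx hx0
    have hb : (2 * p x)⁻¹ • x ∈ B := by
      have : p ((2 * p x)⁻¹ • x) = 1 / 2 := by
        rw [map_smul_eq_mul, Real.norm_of_nonneg (by positivity)]
        field_simp
      exact ⟨⟨C.smul_mem (by positivity) hx, this.le⟩, this⟩
    have := hu _ (subset_closure (subset_convexHull ℝ _ hb))
    rw [map_smul, smul_eq_mul, inv_mul_eq_div, lt_div_iff₀ (by positivity)] at this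
    linarith
  refine ⟨f, fun x hx hx0 => ?_, fun M => ?_⟩
  · have := hpos x hx hx0
    exact lt_of_lt_of_le (by positivity) (hpf x hx)
  · set s : ℝ := |M| / u + 1 with hs
    have hs0 : 0 < s := by positivity
    have : {x | x ∈ C ∧ f x ≤ M} = (s • L) ∩ {x | f x ≤ M} := by
      ext x
      constructor
      · rintro ⟨hx, hfx⟩
        refine ⟨⟨s⁻¹ • x, ⟨C.smul_mem (by positivity) hx, ?_⟩, smul_inv_smul₀ hs0.ne' x⟩, hfx⟩
        rw [map_smul_eq_mul, Real.norm_of_nonneg (by positivity), inv_mul_le_iff₀ hs0]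
        have h1 : 2 * p x * u ≤ |M| := ((hpf x hx).trans hfx).trans (le_abs_self M)
        have h2 : 2 * p x ≤ |M| / u := (le_div_iff₀ hu0).2 h1
        linarith
      · rintro ⟨⟨y, hy, rfl⟩, hfx⟩
        exact ⟨C.smul_mem hs0 hy.1, hfx⟩
    rw [this]
    exact (hLc.smul s).inter_right (isClosed_le f.continuous continuous_const)

end Cone

/-! ### The invariant weakly compact convex set away from `0`. -/

theorem mainTheorem3 {G : Type*} [Group G]
    {E : Type*} [AddCommGroup E] [Module ℝ E] [TopologicalSpace E]
    [IsTopologicalAddGroup E] [ContinuousSMul ℝ E] [LocallyConvexSpace ℝ E] [T2Space E]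
    (C : ConvexCone ℝ E) (hproper : C.IsProperCone)
    (hcompact : IsWeaklyLocallyCompact (C : Set E))
    (π : G →* (E →L[ℝ] E)) (hπ : IsRepresentationOnCone π C)
    (hbounded : IsLocallyBoundedType π C)
    (hdistal : IsDistalOn π (C : Set E)) :
    ∃ x ∈ C, x ≠ 0 ∧ ∀ g : G, π g x = x := by
  obtain ⟨x, hxC, hx0, hxb⟩ := hbounded
  let C' : ConvexCone ℝ (WeakSpace ℝ E) := C.map (toWeakSpace ℝ E).toLinearMap
  have hC' : (C' : Set (WeakSpace ℝ E)) = toWeakSpace ℝ E '' C := rfl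
  have hmemC' : ∀ y, toWeakSpace ℝ E y ∈ C' ↔ y ∈ C := fun y => by
    rw [← SetLike.mem_coe, hC', (toWeakSpace ℝ E).injective.mem_set_image, SetLike.mem_coe]
  have hproper' : C'.IsProperCone := by
    ext y
    obtain ⟨y, rfl⟩ := (toWeakSpace ℝ E).surjective y
    have h := Set.ext_iff.1 hproper y
    simp only [Set.mem_inter_iff, Set.mem_neg, SetLike.mem_coe, Set.mem_singleton_iff] at h ⊢
    rw [← map_neg, hmemC', hmemC', h, LinearEquiv.map_eq_zero_iff]
  have : LocallyCompactSpace (C' : Set (WeakSpace ℝ E)) := hcompact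
  obtain ⟨f', hf'pos, hf'c⟩ := hproper'.exists_isCompact_le
  let f : E →L[ℝ] ℝ := f'.comp (toWeakSpaceCLM ℝ E)
  have hf : ∀ y, f' (toWeakSpace ℝ E y) = f y := fun _ => rfl
  have hfpos : ∀ y ∈ C, y ≠ 0 → 0 < f y := fun y hy hy0 =>
    hf'pos _ ((hmemC' y).2 hy) ((toWeakSpace ℝ E).map_ne_zero_iff.2 hy0)
  have h0C : (0 : E) ∈ C :=
    (show (0 : E) ∈ (C : Set E) ∩ -(C : Set E) by rw [hproper]; rfl).1
  obtain ⟨M, hM⟩ : ∃ M, ∀ g, f (π g x) ≤ M := by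
    have hb := (NormedSpace.isVonNBounded_iff ℝ).1 (hxb.image f)
    obtain ⟨M, hM⟩ := hb.exists_norm_le
    exact ⟨M, fun g => (le_abs_self _).trans (hM _ ⟨_, ⟨g, rfl⟩, rfl⟩)⟩
  obtain ⟨c, hc0, hc⟩ : ∃ c > 0, ∀ g, c ≤ f (π g x) := by
    have hnot := hdistal x hxC 0 h0C hx0
    obtain ⟨p, hp, hpU⟩ := exists_continuous_seminorm_lt_one_subset
      (isClosed_closure.isOpen_compl.mem_nhds hnot)
    have hconv : Convex ℝ {y | y ∈ C' ∧ f' y ≤ 1} :=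
      C'.convex.inter (convex_halfSpace_le f'.toLinearMap.isLinear 1)
    obtain ⟨R, hR⟩ := (hf'c 1).exists_seminorm_le hconv p.toWeakSpace
      (Seminorm.isClosed_toWeakSpace_le hp)
    -- Scaling `z` to `f = 1` gives `p z ≤ f z * R`, while `1 ≤ p z`; the maximum makes the constant
    -- visibly positive.
    refine ⟨(max R 1)⁻¹, by positivity, fun g => ?_⟩
    set z := π g x with hz
    have hzC : z ∈ C := hπ g x hxC
    have hpz : 1 ≤ p z := by
      by_contra! h
      exact hpU z h (subset_closure ⟨g, by simp [hz]⟩)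
    have hz0 : z ≠ 0 := by
      intro h
      rw [h, map_zero] at hpz
      norm_num at hpz
    have hfz := hfpos z hzC hz0
    have hmem := hR (toWeakSpace ℝ E ((f z)⁻¹ • z))
      ⟨(hmemC' _).2 (C.smul_mem (by positivity) hzC), by
        rw [hf, map_smul, smul_eq_mul, inv_mul_cancel₀ hfz.ne']⟩
    rw [Seminorm.toWeakSpace_apply, map_smul_eq_mul, Real.norm_of_nonneg (by positivity),
      inv_mul_le_iff₀ hfz] at hmem
    rw [inv_le_iff_one_le_mul₀ (by positivity)]
    calc 1 ≤ f z * R := hpz.trans hmem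
      _ ≤ f z * max R 1 := by gcongr; exact le_max_left _ _
  let O : Set E := Set.range fun g => π g x
  let K : Set E := closure (convexHull ℝ O)
  have hslab : IsClosed {y | y ∈ C ∧ f y ≤ M} := by
    have h := (hf'c M).isClosed.preimage (toWeakSpaceCLM ℝ E).continuous
    convert h using 1
    ext y
    exact and_congr_left' (hmemC' y).symm
  have hKslab : K ⊆ {y | y ∈ C ∧ f y ≤ M} ∩ {y | c ≤ f y} := by
    refine closure_minimal (convexHull_min ?_ ?_)
      (hslab.inter (isClosed_le continuous_const f.continuous))
    · rintro _ ⟨g, rfl⟩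
      exact ⟨⟨hπ g x hxC, hM g⟩, hc g⟩
    · exact (C.convex.inter (convex_halfSpace_le f.toLinearMap.isLinear M)).inter
        (convex_halfSpace_ge f.toLinearMap.isLinear c)
  have hKconv : Convex ℝ K := (convex_convexHull ℝ O).closure
  have hKc : IsCompact (toWeakSpace ℝ E '' K) := by
    refine (hf'c M).of_isClosed_subset (hKconv.isClosed_toWeakSpace_image isClosed_closure) ?_
    rintro _ ⟨y, hy, rfl⟩
    exact ⟨(hmemC' y).2 (hKslab hy).1.1, (hKslab hy).1.2⟩
  have hKinv : ∀ g, ∀ y ∈ K, π g y ∈ K := by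
    intro g y hy
    have h1 := image_closure_subset_closure_image (π g).continuous (Set.mem_image_of_mem (π g) hy)
    refine closure_mono ?_ h1
    rw [← ContinuousLinearMap.coe_coe, LinearMap.image_convexHull]
    refine convexHull_mono ?_
    rintro _ ⟨_, ⟨h, rfl⟩, rfl⟩
    exact ⟨g * h, by simp⟩
  obtain ⟨y, hyK, hy⟩ := exists_fixedPoint_of_isDistalOn π hKc hKconv
    ⟨x, subset_closure (subset_convexHull ℝ _ ⟨1, by simp⟩)⟩ hKinv
    (fun a ha b hb hab => hdistal a (hKslab ha).1.1 b (hKslab hb).1.1 hab)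
  refine ⟨y, (hKslab hyK).1.1, ?_, hy⟩
  rintro rfl
  have : c ≤ f 0 := (hKslab hyK).2
  rw [map_zero] at this
  exact hc0.not_ge this
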